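/- All manifolds are smooth. Let $n\ge 0$. Let $V_n$ be the set of pairs $(F\times[0,1],L)$, where $F$ is a compact $(n+1)$-manifold, possibly with boundary, and $L$ is a closed $n$-manifold smoothly embedded in the interior of $F\times[0,1]$ that meets every connected component of $F\times[0,1]$. Virtual equivalence is the equivalence relation on $V_n$ generated by - $(F_1\times[0,1],L_1)\sim(F_2\times[0,1],L_2)$ whenever there is a smooth embedding $f:F_1\to F_2$ with $(f\times\mathrm{id}_{[0,1]})(L_1)=L_2$; - $(F\times[0,1],L)\sim(F\times[0,1],L')$ whenever $L$ and $L'$ are smoothly isotopic, i.e. there is a smooth family of smooth embeddings $j_t$ ($t\in[0,1]$) of one closed $n$-manifold in the interior of $F\times[0,1]$ whose images for $t=0$ and $t=1$ are $L$ and $L'$. A virtual $n$-link is a virtual equivalence class. Let $h(F)$ be the quotient space of $F\times[0,1]$ in which all points of $F\times\{1\}$ are identified with each other. **Theorem.** (1) If $(F_1\times[0,1],L_1)$ and $(F_2\times[0,1],L_2)$ in $V_n$ are virtually equivalent, then $h(F_1)-L_1$ and $h(F_2)-L_2$ are homotopy equivalent. (2) If $(F\times[0,1],L)\in V_n$ and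 $F$ is homeomorphic to the ball $D^{n+1}$, then $h(F)-L$ is homotopy equivalent to $(F\times[0,1])-L$. (3) Hence homotopy invariants of complements of links in $D^{n+1}\times[0,1]\cong D^{n+2}$ extend to virtual links: if $I$ is a function on topological spaces that takes equal values on homotopy equivalent spaces, then there is a function $J$ on virtual $n$-links with $J([F\times[0,1],L])=I(h(F)-L)$ for every $(F\times[0,1],L)\in V_n$, and $J([F\times[0,1],L])=I((F\times[0,1])-L)$ whenever $F$ is homeomorphic to $D^{n+1}$. -/

import Mathlib

open scoped Manifold ContDiff

universe u v

/-- A smooth embedding (immersed embedding): a smooth map with injective differential at every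
point which is a homeomorphism onto its image. The condition on the differential is the usual
definition of an immersion, also when source or target have boundary or corners. (Mathlib's
`Manifold.IsSmoothEmbedding` asks for charts in which the map is linear, which excludes, for
instance, the inclusion of a disk whose boundary touches the boundary of the target
tangentially.) -/
structure IsSmoothEmb {E H M E' H' M' : Type*}
    [NormedAddCommGroup E] [NormedSpace ℝ E] [TopologicalSpace H] (I : ModelWithCorners ℝ E H)
    [TopologicalSpace M] [ChartedSpace H M]
    [NormedAddCommGroup E'] [NormedSpace ℝ E'] [TopologicalSpace H'] (I' : ModelWithCorners ℝ E' H')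
    [TopologicalSpace M'] [ChartedSpace H' M'] (f : M → M') : Prop where
  contMDiff : ContMDiff I I' ∞ f
  injective_mfderiv : ∀ x : M, Function.Injective (mfderiv I I' f x)
  isEmbedding : Topology.IsEmbedding f

/-- A closed smooth manifold of dimension `n`: compact, Hausdorff, without boundary, possibly
disconnected or empty. -/
structure ClosedManifold (n : ℕ) where
  carrier : Type u
  [topologicalSpace : TopologicalSpace carrier]
  [chartedSpace : ChartedSpace (EuclideanSpace ℝ (Fin n)) carrier]
  [isManifold : IsManifold (𝓡 n) ∞ carrier]
  [compactSpace : CompactSpace carrier]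
  [t2Space : T2Space carrier]

namespace ClosedManifold

instance (n : ℕ) : CoeSort (ClosedManifold.{u} n) (Type u) := ⟨carrier⟩

attribute [instance] topologicalSpace chartedSpace isManifold compactSpace t2Space

end ClosedManifold

/-- A compact smooth manifold of dimension `n + 1`, possibly with boundary. -/
structure CompactBase (n : ℕ) where
  carrier : Type u
  [topologicalSpace : TopologicalSpace carrier]
  [chartedSpace : ChartedSpace (EuclideanHalfSpace (n + 1)) carrier]
  [isManifold : IsManifold (𝓡∂ (n + 1)) ∞ carrier]
  [compactSpace : CompactSpace carrier]
  [t2Space : T2Space carrier]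

namespace CompactBase

instance (n : ℕ) : CoeSort (CompactBase.{u} n) (Type u) := ⟨carrier⟩

attribute [instance] topologicalSpace chartedSpace isManifold compactSpace t2Space

/-- The thickening `F × [0,1]`, with its product smooth structure. -/
abbrev Thick {n : ℕ} (F : CompactBase.{u} n) : Type u := F × unitInterval

end CompactBase

/-- The model (with corners) of `F × [0,1]`, where `F` has dimension `n + 1`. -/
noncomputable abbrev thickModel (n : ℕ) :=
  (𝓡∂ (n + 1)).prod (𝓡∂ 1)

/-- `L ⊆ F × [0,1]` is a closed `n`-manifold smoothly embedded in the interior of `F × [0,1]`. -/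
def IsLink {n : ℕ} (F : CompactBase.{u} n) (L : Set F.Thick) : Prop :=
  L ⊆ (thickModel n).interior F.Thick ∧
    ∃ (N : ClosedManifold.{u} n) (i : N → F.Thick),
      IsSmoothEmb (𝓡 n) (thickModel n) i ∧ Set.range i = L

/-- Smooth isotopy of links in `F × [0,1]`: a smooth family of smooth embeddings of one closed
`n`-manifold in the interior of `F × [0,1]` from `L` to `L'`. -/
def SmoothlyIsotopic {n : ℕ} (F : CompactBase.{u} n) (L L' : Set F.Thick) : Prop :=
  ∃ (N : ClosedManifold.{u} n) (j : N × unitInterval → F.Thick),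
    ContMDiff ((𝓡 n).prod (𝓡∂ 1)) (thickModel n) ∞ j ∧
    (∀ t : unitInterval, IsSmoothEmb (𝓡 n) (thickModel n) (fun x : N => j (x, t))) ∧
    (∀ p, j p ∈ (thickModel n).interior F.Thick) ∧
    Set.range (fun x : N => j (x, 0)) = L ∧
    Set.range (fun x : N => j (x, 1)) = L'

/-- The set `V_n` of pairs `(F × [0,1], L)`. -/
structure LinkPair (n : ℕ) where
  F : CompactBase.{u} n
  L : Set F.Thick
  isLink : IsLink F L
  meets : ∀ p : F.Thick, (connectedComponent p ∩ L).Nonempty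

/-- The two elementary moves that generate virtual equivalence. -/
inductive VirtualMove {n : ℕ} : LinkPair.{u} n → LinkPair.{u} n → Prop
  /-- an embedding `f : F₁ → F₂` with `(f × id)(L₁) = L₂` -/
  | embed (P Q : LinkPair.{u} n) (f : P.F → Q.F)
      (hf : IsSmoothEmb (𝓡∂ (n + 1)) (𝓡∂ (n + 1)) f)
      (hL : Prod.map f id '' P.L = Q.L) : VirtualMove P Q
  /-- a smooth isotopy of the link, in a fixed `F × [0,1]` -/
  | isotopy (F : CompactBase.{u} n) (L L' : Set F.Thick)
      (h : IsLink F L) (m : ∀ p : F.Thick, (connectedComponent p ∩ L).Nonempty)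
      (h' : IsLink F L') (m' : ∀ p : F.Thick, (connectedComponent p ∩ L').Nonempty)
      (hLL' : SmoothlyIsotopic F L L') : VirtualMove ⟨F, L, h, m⟩ ⟨F, L', h', m'⟩

/-- Virtual equivalence: the equivalence relation generated by the two moves. -/
def virtualSetoid (n : ℕ) : Setoid (LinkPair.{u} n) :=
  Relation.EqvGen.setoid VirtualMove

/-- `P` and `Q` are virtually equivalent. -/
def VirtuallyEquivalent {n : ℕ} (P Q : LinkPair.{u} n) : Prop :=
  (virtualSetoid n).r P Q

/-- Virtual `n`-links: elements of `V_n` up to virtual equivalence. -/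
def VirtualLink (n : ℕ) := Quotient (virtualSetoid.{u} n)

/-- The virtual link represented by a pair. -/
def LinkPair.virtualLink {n : ℕ} (P : LinkPair.{u} n) : VirtualLink.{u} n :=
  Quotient.mk (virtualSetoid n) P

/-- The relation on `X × [0,1]` that identifies all points of `X × {1}` with each other. -/
def coneSetoid (X : Type u) : Setoid (X × unitInterval) where
  r p q := p = q ∨ (p.2 = 1 ∧ q.2 = 1)
  iseqv := by
    refine ⟨fun p => Or.inl rfl, ?_, ?_⟩
    · rintro p q (rfl | ⟨h, h'⟩)
      · exact Or.inl rfl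
      · exact Or.inr ⟨h', h⟩
    · rintro p q r (rfl | ⟨h, h'⟩) (rfl | ⟨k, k'⟩)
      · exact Or.inl rfl
      · exact Or.inr ⟨k, k'⟩
      · exact Or.inr ⟨h, h'⟩
      · exact Or.inr ⟨h, k'⟩

/-- The space `h(X)`: the quotient of `X × [0,1]` that collapses `X × {1}` to a point, with the
quotient topology. -/
abbrev Coned (X : Type u) [TopologicalSpace X] : Type u := Quotient (coneSetoid X)

/-- The space `h(F) - L`. -/
abbrev LinkPair.ConedComplement {n : ℕ} (P : LinkPair.{u} n) : Type u :=
  ↥((Quotient.mk (coneSetoid P.F) '' P.L)ᶜ : Set (Coned P.F))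

/-- The space `(F × [0,1]) - L`. -/
abbrev LinkPair.Complement {n : ℕ} (P : LinkPair.{u} n) : Type u :=
  ↥(P.Lᶜ : Set P.F.Thick)

/-- `F` is an `(n+1)`-ball `D^{n+1}`, so that `(F × [0,1], L)` is a link in
`D^{n+1} × [0,1] = D^{n+2}`. Only the homeomorphism type matters here. -/
def LinkPair.IsInBall {n : ℕ} (P : LinkPair.{u} n) : Prop :=
  Nonempty (P.F ≃ₜ Metric.closedBall (0 : EuclideanSpace ℝ (Fin (n + 1))) 1)

/-!
In the quotient `h(F)` the cone point absorbs everything that does not lie close to the link, and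
this makes the homotopy type of `h(F) - L` a virtual invariant.

*Embeddings.* Let `f : F₁ → F₂` be a smooth embedding that carries `L₁` to `L₂`, and let `K` be the
projection of `L₂` to `F₂`. Since `L₁` lies over the interior of `F₁` and `f` is an immersion in
codimension zero, the image of `f` is a neighbourhood of `K`
(`range_mem_nhds_of_injective_mfderiv`). With a function that is `0` on `K` and `1` off the interior
of the image of `f`, the points of `h(F₂)` are pushed up along the intervals `{y} × [0,1]`: the
points over `K` do not move, those that are not over the image of `f` end in the cone point. This
is a deformation of `h(F₂) - L₂` into `h(F₁) - L₁`
(`Coned.nonempty_homotopyEquiv_compl_of_isEmbedding`).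

*Isotopies.* A smooth isotopy in the interior of `F × [0,1]` is induced by a homeomorphism of
`F × [0,1]` that fixes `F × {1}` (`exists_homeomorph_of_isotopy`), which then acts on `h(F)`. Only a
homeomorphism is needed, and so the flow of a vector field can be avoided. By connectedness of
`[0,1]` it is enough to treat times close to a given `t₀`. A partition of unity on the closed
manifold cuts the motion from time `t₀` to time `t` into finitely many steps, each of them inside
one chart of `F × [0,1]`. In the chart, the displacement of a step has a small Lipschitz constant
as a function of the position (`eventually_displacement_le_diag` near the diagonal, compactness
away from it), so it extends to a Lipschitz map `w` on the model space with a constant less than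
`1`, and `id + w` is a homeomorphism (`exists_homeomorph_of_lipschitz_displacement`).

*Links in a ball.* If `F` is contractible, a contraction of `F`, performed gradually above the level
of the link, maps `F × {1}` to a point and hence gives a homotopy inverse of the quotient map
`(F × [0,1]) - L → h(F) - L` (`Coned.nonempty_homotopyEquiv_compl_of_contractible`).

The extension of homotopy invariants to virtual links is a formal consequence.
-/

open Set Filter Topology

/-! ### Maps and homotopies out of the coned space -/

section Cone

open unitInterval

namespace Coned

variable {X Y Z S : Type*} [TopologicalSpace X] [TopologicalSpace Y] [TopologicalSpace Z]
  [TopologicalSpace S]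

/-- The quotient map `X × [0,1] → h(X)`. -/
abbrev mk (p : X × I) : Coned X := Quotient.mk (coneSetoid X) p

lemma mk_eq_mk {p q : X × I} : mk p = mk q ↔ p = q ∨ (p.2 = 1 ∧ q.2 = 1) := Quotient.eq

lemma isQuotientMap_mk : IsQuotientMap (mk : X × I → Coned X) := isQuotientMap_quotient_mk'

lemma mk_mem_image_iff {L : Set (X × I)} (hL : ∀ p ∈ L, p.2 ≠ 1) {p : X × I} :
    mk p ∈ mk '' L ↔ p ∈ L := by
  refine ⟨?_, fun h => ⟨p, h, rfl⟩⟩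
  rintro ⟨q, hq, h⟩
  rcases mk_eq_mk.1 h with rfl | h
  · exact hq
  · exact absurd h.1 (hL q hq)

/-- A map on `X × [0,1]` that is constant on `X × {1}` descends to `h(X)`. -/
def lift (g : C(X × I, Z)) (hg : ∀ x y, g (x, 1) = g (y, 1)) : C(Coned X, Z) where
  toFun := Quotient.lift g (by
    rintro ⟨x, t⟩ ⟨y, t'⟩ (h | ⟨h, h'⟩)
    · rw [h]
    · obtain rfl : t = 1 := h
      obtain rfl : t' = 1 := h'
      exact hg x y)
  continuous_toFun := g.continuous.quotient_lift _

/-- The version of `Coned.lift` with a parameter; it descends homotopies. -/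
def liftProd [LocallyCompactSpace S] (g : C((X × I) × S, Z))
    (hg : ∀ x y s, g ((x, 1), s) = g ((y, 1), s)) : C(Coned X × S, Z) where
  toFun q := Quotient.lift (fun p => g (p, q.2)) (by
    rintro ⟨x, t⟩ ⟨y, t'⟩ (h | ⟨h, h'⟩)
    · rw [h]
    · obtain rfl : t = 1 := h
      obtain rfl : t' = 1 := h'
      exact hg x y _) q.1
  continuous_toFun := isQuotientMap_mk.continuous_lift_prod_left g.continuous

end Coned

/-- Maps and homotopies of the ambient spaces that respect two complements restrict to a homotopy
equivalence of the complements. -/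
lemma nonempty_homotopyEquiv_compl {X Y : Type*} [TopologicalSpace X] [TopologicalSpace Y]
    {A : Set X} {B : Set Y} (f : C(X, Y)) (g : C(Y, X)) (H : C(X × I, X)) (K : C(Y × I, Y))
    (hf : MapsTo f Aᶜ Bᶜ) (hg : MapsTo g Bᶜ Aᶜ)
    (hH : ∀ x ∈ Aᶜ, ∀ s, H (x, s) ∈ Aᶜ) (hK : ∀ y ∈ Bᶜ, ∀ s, K (y, s) ∈ Bᶜ)
    (H0 : ∀ x, H (x, 0) = x) (H1 : ∀ x, H (x, 1) = g (f x))
    (K0 : ∀ y, K (y, 0) = y) (K1 : ∀ y, K (y, 1) = f (g y)) :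
    Nonempty (ContinuousMap.HomotopyEquiv ↥(Aᶜ) ↥(Bᶜ)) := by
  refine ⟨⟨⟨hf.restrict, by fun_prop⟩, ⟨hg.restrict, by fun_prop⟩, ?_, ?_⟩⟩
  · refine ContinuousMap.Homotopic.symm ⟨⟨⟨fun p => ⟨H (p.2, p.1), hH _ p.2.2 _⟩, by fun_prop⟩,
      fun x => Subtype.ext (H0 x), fun x => Subtype.ext (H1 x)⟩⟩
  · refine ContinuousMap.Homotopic.symm ⟨⟨⟨fun p => ⟨K (p.2, p.1), hK _ p.2.2 _⟩, by fun_prop⟩,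
      fun x => Subtype.ext (K0 x), fun x => Subtype.ext (K1 x)⟩⟩

namespace Coned

variable {X Y : Type*} [TopologicalSpace X] [TopologicalSpace Y]

/-- The homotopy of `h(X)` that pushes `(x, t)` towards the cone point along `{x} × [0,1]`: at time
`s` the distance `1 - t` to the cone point is multiplied by `1 - s * lam x`. -/
def push (lam : C(X, I)) : C(Coned X × I, Coned X) :=
  liftProd ⟨fun q => mk (q.1.1, σ (σ q.1.2 * σ (q.2 * lam q.1.1))),
    continuous_quotient_mk'.comp (by fun_prop)⟩ (fun x y s => mk_eq_mk.2 (Or.inr (by simp)))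

@[simp] lemma push_mk (lam : C(X, I)) (x : X) (t s : I) :
    push lam (mk (x, t), s) = mk (x, σ (σ t * σ (s * lam x))) := rfl

lemma push_mem_compl {lam : C(X, I)} {L : Set (X × I)} (h1 : ∀ p ∈ L, p.2 ≠ 1)
    (hlam : ∀ p ∈ L, lam p.1 = 0) : ∀ x ∈ (mk '' L)ᶜ, ∀ s, push lam (x, s) ∈ (mk '' L)ᶜ := by
  rintro ⟨x, t⟩ hx s hs
  erw [push_mk, mk_mem_image_iff h1] at hs
  have := hlam _ hs
  apply hx
  erw [mk_mem_image_iff h1]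
  simpa [show lam x = 0 from this] using hs

/-- Enlarging the base does not change the homotopy type of the complement of `L` in the coned
space. Everything over the complement of a neighbourhood of the projection of `L` is pushed into
the cone point, so that the larger coned space retracts onto the smaller one by a deformation
which does not move `L`. -/
theorem nonempty_homotopyEquiv_compl_of_isEmbedding [CompactSpace X] [Nonempty X] [CompactSpace Y]
    [T2Space Y] {f : X → Y} (hf : IsEmbedding f) {L : Set (X × I)} (hL : IsCompact L)
    (h1 : ∀ p ∈ L, p.2 ≠ 1) (hint : ∀ p ∈ L, f p.1 ∈ interior (range f)) :
    Nonempty (ContinuousMap.HomotopyEquiv ↥((mk '' L)ᶜ : Set (Coned X))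
      ↥((mk '' (Prod.map f id '' L))ᶜ : Set (Coned Y))) := by
  have hfc := hf.continuous
  have hKc : IsClosed ((fun p : X × I => f p.1) '' L) :=
    (hL.image (hfc.comp continuous_fst)).isClosed
  obtain ⟨lam₀, h0, hone, h01⟩ := exists_continuous_zero_one_of_isClosed hKc
    (isOpen_interior (s := range f)).isClosed_compl (by
      rw [disjoint_compl_right_iff_subset]
      rintro _ ⟨p, hp, rfl⟩
      exact hint p hp)
  let lam : C(Y, I) := ⟨fun y => ⟨lam₀ y, h01 y⟩, by fun_prop⟩
  have hlam0 : ∀ p ∈ L, lam (f p.1) = 0 := fun p hp => Subtype.ext (h0 ⟨p, hp, rfl⟩)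
  have hlam1 : ∀ y ∉ interior (range f), lam y = 1 := fun y hy => Subtype.ext (hone hy)
  have hinv : ∀ x, Function.invFun f (f x) = x := Function.leftInverse_invFun hf.injective
  have h1' : ∀ p ∈ Prod.map f id '' L, p.2 ≠ 1 := by
    rintro _ ⟨p, hp, rfl⟩
    exact h1 p hp
  -- The retraction is continuous on each of the two closed sets `range f × [0,1]` and
  -- `(interior (range f))ᶜ × [0,1]`; on the second one it is constant.
  have hr : Continuous fun p : Y × I => mk (Function.invFun f p.1, σ (σ p.2 * σ (lam p.1))) := by
    have hU : (Prod.fst ⁻¹' range f : Set (Y × I)) ∪ Prod.fst ⁻¹' (interior (range f))ᶜ = univ := by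
      rw [← preimage_union, eq_univ_iff_forall]
      intro p
      by_cases hp : p.1 ∈ range f
      · exact Or.inl hp
      · exact Or.inr fun h => hp (interior_subset h)
    rw [← continuousOn_univ, ← hU]
    refine ContinuousOn.union_of_isClosed ?_ ?_
      ((isCompact_range hfc).isClosed.preimage continuous_fst)
      (isOpen_interior.isClosed_compl.preimage continuous_fst)
    · refine continuous_quotient_mk'.comp_continuousOn (ContinuousOn.prodMk ?_ (by fun_prop))
      have : ContinuousOn (Function.invFun f) (range f) := by
        rw [continuousOn_iff_continuous_domRestrict]
        have he : (range f).domRestrict (Function.invFun f) = hf.toHomeomorph.symm := by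
          ext ⟨_, x, rfl⟩
          change Function.invFun f (f x) = hf.toHomeomorph.symm (hf.toHomeomorph x)
          rw [hf.toHomeomorph.symm_apply_apply, hinv]
        rw [he]
        exact hf.toHomeomorph.symm.continuous
      exact this.comp continuous_fst.continuousOn (fun _ h => h)
    · refine (continuousOn_const (c := mk (Classical.arbitrary X, 1))).congr fun p hp => ?_
      exact mk_eq_mk.2 (Or.inr ⟨by simp [hlam1 p.1 hp], rfl⟩)
  let F : C(Coned X, Coned Y) := lift ⟨fun p => mk (f p.1, p.2), continuous_quotient_mk'.comp
    (by fun_prop)⟩ (fun x y => mk_eq_mk.2 (Or.inr ⟨rfl, rfl⟩))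
  let R : C(Coned Y, Coned X) := lift ⟨_, hr⟩
    (fun x y => mk_eq_mk.2 (Or.inr ⟨by simp, by simp⟩))
  have hRF : ∀ x, push (lam.comp ⟨f, hfc⟩) (x, 1) = R (F x) := by
    rintro ⟨x, t⟩
    change push _ (mk _, 1) = mk (Function.invFun f (f x), _)
    rw [hinv]
    simp
  have hFR : ∀ y, push lam (y, 1) = F (R y) := by
    rintro ⟨y, t⟩
    change mk _ = mk (f (Function.invFun f y), _)
    by_cases hy : y ∈ interior (range f)
    · obtain ⟨x, rfl⟩ := interior_subset hy
      rw [hinv]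
      simp
    · exact mk_eq_mk.2 (Or.inr ⟨by simp [hlam1 y hy], by simp [hlam1 y hy]⟩)
  refine nonempty_homotopyEquiv_compl F R (push (lam.comp ⟨f, hfc⟩)) (push lam) ?_ ?_
    (push_mem_compl h1 hlam0) (push_mem_compl h1' ?_) ?_ hRF ?_ hFR
  · rintro ⟨x, t⟩ hx hFx
    have hFx' : mk (f x, t) ∈ mk '' (Prod.map f id '' L) := hFx
    rw [mk_mem_image_iff h1'] at hFx'
    obtain ⟨⟨x', t'⟩, hp, he⟩ := hFx'
    obtain ⟨h, rfl⟩ := Prod.mk.inj he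
    obtain rfl := hf.injective h
    exact hx ⟨_, hp, rfl⟩
  · rintro ⟨y, t⟩ hy hRy
    have hRy' : mk (Function.invFun f y, σ (σ t * σ (lam y))) ∈ mk '' L := hRy
    rw [mk_mem_image_iff h1] at hRy'
    by_cases hyi : y ∈ interior (range f)
    · obtain ⟨x, rfl⟩ := interior_subset hyi
      rw [hinv] at hRy'
      have := hlam0 _ hRy'
      dsimp only at this
      simp only [this, symm_zero, mul_one, symm_symm] at hRy'
      exact hy ⟨_, ⟨_, hRy', rfl⟩, rfl⟩
    · exact h1 _ hRy' (by simp [hlam1 y hyi])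
  · rintro _ ⟨p, hp, rfl⟩
    exact hlam0 p hp
  · rintro ⟨x, t⟩
    change push _ (mk _, 0) = mk _
    simp
  · rintro ⟨x, t⟩
    change push _ (mk _, 0) = mk _
    simp

/-- Coning off one end of a contractible base does not change the homotopy type of the complement
of `L`: a contraction of the base, performed above the level of `L`, inverts the quotient map. -/
theorem nonempty_homotopyEquiv_compl_of_contractible [ContractibleSpace X] {L : Set (X × I)}
    (hL : IsCompact L) (h1 : ∀ p ∈ L, p.2 ≠ 1) :
    Nonempty (ContinuousMap.HomotopyEquiv ↥((mk '' L)ᶜ : Set (Coned X)) ↥(Lᶜ)) := by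
  obtain ⟨x₀, ⟨c⟩⟩ := id_nullhomotopic X
  obtain ⟨mu₀, h0, hone, h01⟩ := exists_continuous_zero_one_of_isClosed
    (hL.image continuous_snd).isClosed (isClosed_singleton (x := (1 : I))) (by
      rw [disjoint_singleton_right]
      rintro ⟨p, hp, h⟩
      exact h1 p hp h)
  let mu : C(I, I) := ⟨fun y => ⟨mu₀ y, h01 y⟩, by fun_prop⟩
  have hmu0 : ∀ p ∈ L, mu p.2 = 0 := fun p hp => Subtype.ext (h0 ⟨p, hp, rfl⟩)
  have hmu1 : mu 1 = 1 := Subtype.ext (hone rfl)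
  have hc0 : ∀ x, c (0, x) = x := fun x => c.apply_zero x
  have hc1 : ∀ x, c (1, x) = x₀ := fun x => c.apply_one x
  let G : C(Coned X, X × I) := lift ⟨fun p => (c (mu p.2, p.1), p.2), by fun_prop⟩
    (fun x y => by simp [hmu1, hc1])
  let Q : C(X × I, Coned X) := ⟨mk, continuous_quotient_mk'⟩
  let K : C((X × I) × I, X × I) := ⟨fun q => (c (q.2 * mu q.1.2, q.1.1), q.1.2), by fun_prop⟩
  have hK : ∀ p ∈ Lᶜ, ∀ s, K (p, s) ∈ Lᶜ := by
    rintro ⟨x, t⟩ hp s (hs : (c (s * mu t, x), t) ∈ L)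
    have := hmu0 _ hs
    dsimp only at this
    rw [this, mul_zero, hc0] at hs
    exact hp hs
  have hG1 : ∀ p, K (p, 1) = G (Q p) := by
    rintro ⟨x, t⟩
    change (c (1 * mu t, x), t) = (c (mu t, x), t)
    rw [one_mul]
  have hKL : ∀ p s, mk p ∈ (mk '' L)ᶜ → K (p, s) ∈ Lᶜ := fun p s hp =>
    hK p (fun h => hp ⟨p, h, rfl⟩) s
  refine nonempty_homotopyEquiv_compl G Q
    (liftProd (Q.comp K) fun x y s => mk_eq_mk.2 (Or.inr ⟨rfl, rfl⟩)) K ?_ ?_ ?_ hK ?_ ?_ ?_ hG1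
  · rintro ⟨p⟩ hp
    have := hKL p 1 hp
    rwa [hG1] at this
  · intro p hp
    exact fun h => hp ((mk_mem_image_iff h1).1 h)
  · rintro ⟨p⟩ hp s h
    exact hKL p s hp ((mk_mem_image_iff h1).1 h)
  · rintro ⟨x, t⟩
    change mk (c (0 * mu t, x), t) = mk (x, t)
    rw [zero_mul, hc0]
  · rintro ⟨p⟩
    exact congrArg mk (hG1 p)
  · rintro ⟨x, t⟩
    change (c (0 * mu t, x), t) = (x, t)
    rw [zero_mul, hc0]

/-- A homeomorphism of `X × [0,1]` that fixes the top induces one of `h(X)`. -/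
theorem nonempty_homotopyEquiv_compl_of_homeomorph {L : Set (X × I)} (e : X × I ≃ₜ X × I)
    (he : ∀ x, e (x, 1) = (x, 1)) (h1 : ∀ p ∈ L, p.2 ≠ 1) :
    Nonempty (ContinuousMap.HomotopyEquiv ↥((mk '' L)ᶜ : Set (Coned X))
      ↥((mk '' (e '' L))ᶜ : Set (Coned X))) := by
  have he' : ∀ x, e.symm (x, 1) = (x, 1) := fun x => by rw [e.symm_apply_eq, he]
  have h1' : ∀ p ∈ e '' L, p.2 ≠ 1 := by
    rintro _ ⟨p, hp, rfl⟩ h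
    have hp' : e p = e ((e p).1, 1) := (Prod.ext rfl h : e p = ((e p).1, 1)).trans (he _).symm
    exact h1 p hp (congrArg Prod.snd (e.injective hp'))
  have htop : ∀ x y, mk (e (x, 1)) = mk (e (y, 1)) := fun x y => by
    rw [he, he]
    exact mk_eq_mk.2 (Or.inr ⟨rfl, rfl⟩)
  have htop' : ∀ x y, mk (e.symm (x, 1)) = mk (e.symm (y, 1)) := fun x y => by
    rw [he', he']
    exact mk_eq_mk.2 (Or.inr ⟨rfl, rfl⟩)
  refine nonempty_homotopyEquiv_compl
    (lift ⟨fun p => mk (e p), continuous_quotient_mk'.comp e.continuous⟩ htop)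
    (lift ⟨fun p => mk (e.symm p), continuous_quotient_mk'.comp e.symm.continuous⟩ htop')
    ⟨Prod.fst, continuous_fst⟩ ⟨Prod.fst, continuous_fst⟩ ?_ ?_ (fun x hx _ => hx)
    (fun x hx _ => hx) (fun _ => rfl) ?_ (fun _ => rfl) ?_
  · rintro ⟨p⟩ hp h
    obtain ⟨q, hq, hqp⟩ := (mk_mem_image_iff h1').1 h
    exact hp ⟨p, e.injective hqp ▸ hq, rfl⟩
  · rintro ⟨p⟩ hp h
    exact hp ⟨p, ⟨_, (mk_mem_image_iff h1).1 h, e.apply_symm_apply p⟩, rfl⟩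
  · rintro ⟨p⟩
    exact congrArg mk (e.symm_apply_apply p).symm
  · rintro ⟨p⟩
    exact congrArg mk (e.apply_symm_apply p).symm

end Coned

end Cone

/-! ### Homeomorphisms supported in a chart -/

/-- Extending a homeomorphism of the model space with compact support in the target of a chart by
the identity gives a continuous map. -/
lemma OpenPartialHomeomorph.continuous_extend_by_id {M E : Type*} [TopologicalSpace M] [T2Space M]
    [TopologicalSpace E] (e : OpenPartialHomeomorph M E) {K : Set E} (hK : IsCompact K)
    (hKe : K ⊆ e.target) {g : E → E} (hg : Continuous g) (hgK : ∀ y ∉ K, g y = y)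
    (hgt : MapsTo g e.target e.target) [DecidablePred (· ∈ e.source)] :
    Continuous fun x => if x ∈ e.source then e.symm (g (e x)) else x := by
  have hc : IsClosed (e.symm '' K) :=
    (hK.image_of_continuousOn (e.continuousOn_symm.mono hKe)).isClosed
  rw [continuous_iff_continuousAt]
  intro x
  by_cases hx : x ∈ e.source
  · have h1 : ContinuousAt (fun x => e.symm (g (e x))) x :=
      (e.symm.continuousAt (hgt (e.map_source hx))).comp (f := g ∘ e)
        (hg.continuousAt.comp (f := e) (e.continuousAt hx))
    refine h1.congr ?_
    filter_upwards [e.open_source.mem_nhds hx] with y hy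
    rw [if_pos hy]
  · have hxK : x ∉ e.symm '' K := by
      rintro ⟨y, hy, rfl⟩
      exact hx (e.map_target (hKe hy))
    refine continuousAt_id.congr ?_
    filter_upwards [hc.isOpen_compl.mem_nhds hxK] with y hy
    split_ifs with hys
    · have : e y ∉ K := fun h => hy ⟨_, h, e.left_inv hys⟩
      rw [hgK _ this, e.left_inv hys, id]
    · rfl

/-- A homeomorphism of the model space with compact support in the target of a chart, transported
to the manifold and extended by the identity. -/
lemma OpenPartialHomeomorph.exists_homeomorph_extend_by_id {M E : Type*} [TopologicalSpace M]
    [T2Space M] [TopologicalSpace E] (e : OpenPartialHomeomorph M E) {K : Set E} (hK : IsCompact K)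
    (hKe : K ⊆ e.target) (g : E ≃ₜ E) (hgK : ∀ y ∉ K, g y = y) :
    ∃ Φ : M ≃ₜ M, (∀ x ∈ e.source, Φ x = e.symm (g (e x))) ∧ ∀ x ∉ e.source, Φ x = x := by
  classical
  have key : ∀ g : E ≃ₜ E, (∀ y ∉ K, g y = y) → MapsTo g e.target e.target := by
    intro g hg y hy
    by_cases h : g y ∈ K
    · exact hKe h
    · rwa [g.injective (hg _ h)]
  have hgK' : ∀ y ∉ K, g.symm y = y := fun y hy => by rw [g.symm_apply_eq, hgK y hy]
  have inv : ∀ g : E ≃ₜ E, (∀ y ∉ K, g y = y) → ∀ x,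
      (fun x => if x ∈ e.source then e.symm (g.symm (e x)) else x)
        ((fun x => if x ∈ e.source then e.symm (g (e x)) else x) x) = x := by
    intro g hg x
    by_cases hx : x ∈ e.source
    · have h1 := key g hg (e.map_source hx)
      simp [hx, e.map_target h1, e.right_inv h1]
    · simp [hx]
  refine ⟨⟨⟨fun x => if x ∈ e.source then e.symm (g (e x)) else x,
    fun x => if x ∈ e.source then e.symm (g.symm (e x)) else x, inv g hgK, inv g.symm hgK'⟩,
    e.continuous_extend_by_id hK hKe g.continuous hgK (key g hgK),
    e.continuous_extend_by_id hK hKe g.symm.continuous hgK' (key _ hgK')⟩,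
    fun x hx => if_pos hx, fun x hx => if_neg hx⟩

/-- Points of a finite-dimensional space can be moved by any displacement with a small enough
Lipschitz constant: the displacement extends to a Lipschitz map `w` on the whole space, and
`id + w` is a homeomorphism. -/
lemma exists_homeomorph_of_lipschitz_displacement (E : Type*) [NormedAddCommGroup E]
    [NormedSpace ℝ E] [FiniteDimensional ℝ E] :
    ∃ c > (0 : ℝ), ∀ {ι : Type*} (a d : ι → E), (∀ i j, ‖d i - d j‖ ≤ c * ‖a i - a j‖) →
      ∃ g : E ≃ₜ E, ∀ i, g (a i) = a i + d i := by
  have : CompleteSpace E := FiniteDimensional.complete ℝ E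
  have hC := lipschitzExtensionConstant_pos E
  refine ⟨((lipschitzExtensionConstant E)⁻¹ / 2 : NNReal), by positivity, fun {ι} a d h => ?_⟩
  have hfac : d.FactorsThrough a := fun i j hij => by
    have := h i j
    rw [hij, sub_self, norm_zero, mul_zero] at this
    exact sub_eq_zero.1 (norm_le_zero_iff.1 this)
  have hlip : LipschitzOnWith ((lipschitzExtensionConstant E)⁻¹ / 2) (Function.extend a d 0)
      (range a) := by
    rw [lipschitzOnWith_iff_norm_sub_le]
    rintro _ ⟨i, rfl⟩ _ ⟨j, rfl⟩
    rw [hfac.extend_apply, hfac.extend_apply]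
    exact h i j
  obtain ⟨w, hw, hwe⟩ := hlip.extend_finite_dimension
  have hhalf : lipschitzExtensionConstant E * ((lipschitzExtensionConstant E)⁻¹ / 2) = 1 / 2 := by
    field_simp
  rw [hhalf] at hw
  have happ : ApproximatesLinearOn (fun x => x + w x)
      ((ContinuousLinearEquiv.refl ℝ E : E ≃L[ℝ] E) : E →L[ℝ] E) univ (1 / 2) := by
    intro x _ y _
    have := hw.norm_sub_le x y
    have heq : x + w x - (y + w y) - (x - y) = w x - w y := by abel
    change ‖x + w x - (y + w y) - (x - y)‖ ≤ _
    rwa [heq]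
  have hs : Subsingleton E ∨
      (1 / 2 : NNReal) < ‖((ContinuousLinearEquiv.refl ℝ E).symm : E →L[ℝ] E)‖₊⁻¹ := by
    rcases subsingleton_or_nontrivial E with hE | hE
    · exact Or.inl hE
    · right
      have : ‖((ContinuousLinearEquiv.refl ℝ E).symm : E →L[ℝ] E)‖₊ = 1 :=
        NNReal.eq (ContinuousLinearMap.norm_id (𝕜 := ℝ) (E := E))
      rw [this, inv_one]
      exact NNReal.half_lt_self one_ne_zero
  refine ⟨happ.toHomeomorph _ hs, fun i => ?_⟩
  change a i + w (a i) = _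
  rw [← hwe (mem_range_self i), hfac.extend_apply]

/-! ### Immersions in codimension zero -/

/-- A map between manifolds of the same dimension whose differential at an interior point is
injective is open there. -/
lemma range_mem_nhds_of_injective_mfderiv {E H M E' H' M' : Type*}
    [NormedAddCommGroup E] [NormedSpace ℝ E] [FiniteDimensional ℝ E] [TopologicalSpace H]
    {I : ModelWithCorners ℝ E H} [TopologicalSpace M] [ChartedSpace H M]
    [NormedAddCommGroup E'] [NormedSpace ℝ E'] [FiniteDimensional ℝ E'] [TopologicalSpace H']
    {I' : ModelWithCorners ℝ E' H'} [TopologicalSpace M'] [ChartedSpace H' M']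
    (hdim : Module.finrank ℝ E = Module.finrank ℝ E') {f : M → M'} {x : M}
    (hf : ContMDiffAt I I' ∞ f x) (hinj : Function.Injective (mfderiv I I' f x))
    (hx : I.IsInteriorPoint x) : range f ∈ 𝓝 (f x) := by
  have : CompleteSpace E := FiniteDimensional.complete ℝ E
  have : CompleteSpace E' := FiniteDimensional.complete ℝ E'
  have hr : range I ∈ 𝓝 (extChartAt I x x) := mem_interior_iff_mem_nhds.1 hx
  have hmd := hf.mdifferentiableAt (by simp)
  set F := writtenInExtChartAt I I' x f with hF
  have hcd : ContDiffAt ℝ ∞ F (extChartAt I x x) :=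
    ((contMDiffAt_iff.1 hf).2).contDiffAt hr
  have hd : mfderiv I I' f x = fderiv ℝ F (extChartAt I x x) := by
    rw [hmd.mfderiv, fderivWithin_of_mem_nhds hr]
  have hstrict := hcd.hasStrictFDerivAt (by simp)
  have hsurj : (fderiv ℝ F (extChartAt I x x)).range = ⊤ := by
    rw [LinearMap.range_eq_top]
    refine (LinearMap.injective_iff_surjective_of_finrank_eq_finrank hdim).1 ?_
    rw [hd] at hinj
    exact hinj
  have hmap := hstrict.map_nhds_eq_of_surj hsurj
  have hFx : F (extChartAt I x x) = extChartAt I' (f x) (f x) := by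
    simp [hF, writtenInExtChartAt]
  -- `F` takes the points that stay in the chart at `f x` to a neighbourhood.
  have hcont : ContinuousAt (fun z => f ((extChartAt I x).symm z)) (extChartAt I x x) := by
    refine ContinuousAt.comp (g := f) ?_ (continuousAt_extChartAt_symm x)
    rw [extChartAt_to_inv]
    exact hf.continuousAt
  have hW : F '' ((fun z => f ((extChartAt I x).symm z)) ⁻¹' (extChartAt I' (f x)).source)
      ∈ 𝓝 (extChartAt I' (f x) (f x)) := by
    rw [← hFx, ← hmap]
    refine image_mem_map (hcont.preimage_mem_nhds ?_)
    rw [extChartAt_to_inv]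
    exact extChartAt_source_mem_nhds (f x)
  filter_upwards [(continuousAt_extChartAt (I := I') (f x)).preimage_mem_nhds hW,
    extChartAt_source_mem_nhds (I := I') (f x)] with y ⟨z, hz, hzy⟩ hy
  exact ⟨_, (extChartAt I' (f x)).injOn hz hy hzy⟩

/-! ### Strict differentiability of families of maps -/

/-- A `C¹` function on `G × [0,1]` is uniformly close to its linearization in the first variable
near a point, up to a Lipschitz term in the second variable. -/
lemma exists_linear_approx_of_contDiffWithinAt {G E : Type*} [NormedAddCommGroup G]
    [NormedSpace ℝ G] [NormedAddCommGroup E] [NormedSpace ℝ E] {f : G × ℝ → E} {u₀ : G} {t₀ : ℝ}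
    (ht₀ : t₀ ∈ Icc (0 : ℝ) 1) (hf : ContDiffWithinAt ℝ 1 f (univ ×ˢ Icc 0 1) (u₀, t₀)) :
    ∃ A : G →L[ℝ] E, HasFDerivAt (fun u => f (u, t₀)) A u₀ ∧ ∃ K : ℝ, 0 ≤ K ∧ ∀ C > 0,
      ∀ᶠ p : (G × ℝ) × (G × ℝ) in 𝓝 ((u₀, t₀), (u₀, t₀)), p.1.2 ∈ Icc (0 : ℝ) 1 →
        p.2.2 ∈ Icc (0 : ℝ) 1 → ‖f p.1 - f p.2 - A (p.1.1 - p.2.1)‖ ≤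
          C * ‖p.1.1 - p.2.1‖ + K * |p.1.2 - p.2.2| := by
  set S : Set (G × ℝ) := univ ×ˢ Icc 0 1 with hS
  have hz : (u₀, t₀) ∈ S := ⟨mem_univ _, ht₀⟩
  obtain ⟨w, hw, hwS, -, f', hf', hf'c⟩ :=
    (contDiffWithinAt_succ_iff_hasFDerivWithinAt' (n := 0) (by simp)).1
      (by simpa using hf)
  rw [insert_eq_of_mem hz] at hw hwS
  set D := f' (u₀, t₀) with hD
  refine ⟨D.comp (ContinuousLinearMap.inl ℝ G ℝ), ?_, ‖D‖ + 1, by positivity, fun C hC => ?_⟩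
  · have h := hf' (u₀, t₀) (mem_of_mem_nhdsWithin hz hw)
    have hm : MapsTo (fun u : G => (u, t₀)) univ S := fun u _ => ⟨mem_univ _, ht₀⟩
    rw [← hasFDerivWithinAt_univ]
    exact h.comp u₀ (hasFDerivAt_prodMk_left u₀ t₀).hasFDerivWithinAt hm
  · have hC' : 0 < min C 1 := lt_min hC one_pos
    have h1 : ∀ᶠ z in 𝓝[S] (u₀, t₀), ‖f' z - D‖ ≤ min C 1 := by
      filter_upwards [hf'c.continuousWithinAt (Metric.ball_mem_nhds _ hC')] with z hz
      exact (mem_ball_iff_norm.1 hz).le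
    obtain ⟨δ, hδ, hball⟩ := Metric.mem_nhdsWithin_iff.1 (inter_mem hw h1)
    have hconv : Convex ℝ (Metric.ball (u₀, t₀) δ ∩ S) :=
      (convex_ball _ _).inter (convex_univ.prod (convex_Icc 0 1))
    filter_upwards [prod_mem_nhds (Metric.ball_mem_nhds (u₀, t₀) hδ)
      (Metric.ball_mem_nhds (u₀, t₀) hδ)] with p hp hp1 hp2
    have h := hconv.norm_image_sub_le_of_norm_hasFDerivWithin_le' (φ := D) (C := min C 1)
      (fun x hx => (hf' x (hball hx).1).mono inter_subset_right) (fun x hx => (hball hx).2)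
      (x := p.2) (y := p.1) ⟨hp.2, mem_univ _, hp2⟩ ⟨hp.1, mem_univ _, hp1⟩
    have hsplit : D (p.1 - p.2) = D (p.1.1 - p.2.1, 0) + D (0, p.1.2 - p.2.2) := by
      rw [← map_add]
      congr 1
      ext <;> simp
    have hD2 : ‖D (0, p.1.2 - p.2.2)‖ ≤ ‖D‖ * |p.1.2 - p.2.2| := by
      refine (D.le_opNorm _).trans_eq ?_
      rw [Prod.norm_mk, norm_zero, Real.norm_eq_abs, max_eq_right (abs_nonneg _)]
    have hnorm : ‖p.1 - p.2‖ ≤ ‖p.1.1 - p.2.1‖ + |p.1.2 - p.2.2| :=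
      max_le_add_of_nonneg (norm_nonneg _) (abs_nonneg _)
    calc ‖f p.1 - f p.2 - D (p.1.1 - p.2.1, 0)‖
        = ‖(f p.1 - f p.2 - D (p.1 - p.2)) + D (0, p.1.2 - p.2.2)‖ := by
          rw [hsplit]
          congr 1
          abel
      _ ≤ min C 1 * ‖p.1 - p.2‖ + ‖D‖ * |p.1.2 - p.2.2| :=
          (norm_add_le _ _).trans (add_le_add h hD2)
      _ ≤ min C 1 * (‖p.1.1 - p.2.1‖ + |p.1.2 - p.2.2|) + ‖D‖ * |p.1.2 - p.2.2| := by gcongr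
      _ = min C 1 * ‖p.1.1 - p.2.1‖ + (‖D‖ + min C 1) * |p.1.2 - p.2.2| := by ring
      _ ≤ C * ‖p.1.1 - p.2.1‖ + (‖D‖ + 1) * |p.1.2 - p.2.2| := by
          gcongr
          · exact min_le_left _ _
          · exact min_le_right _ _

/-! ### Small displacements of an immersion -/

/-- The time `t₀ + s x * (t - t₀)`, truncated to `[0,1]`: where `s` runs from `0` to `1` it
interpolates between `t₀` and `t`. -/
noncomputable def slide {N : Type*} (t₀ : unitInterval) (s : N → ℝ) (t : unitInterval) (x : N) :
    unitInterval :=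
  projIcc 0 1 zero_le_one (t₀ + s x * (t - t₀))

@[simp] lemma slide_self {N : Type*} (t₀ : unitInterval) (s : N → ℝ) (x : N) :
    slide t₀ s t₀ x = t₀ := by
  simp [slide]

lemma continuous_slide {N : Type*} [TopologicalSpace N] {t₀ : unitInterval} {s : N → ℝ}
    (hs : Continuous s) :
    Continuous fun p : unitInterval × N => slide t₀ s p.1 p.2 :=
  continuous_projIcc.comp (by fun_prop)

lemma abs_slide_sub_le {N : Type*} (t₀ : unitInterval) (s : N → ℝ) (t : unitInterval) (x y : N) :
    |(slide t₀ s t x : ℝ) - slide t₀ s t y| ≤ |s x - s y| * |(t : ℝ) - t₀| := by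
  refine (abs_projIcc_sub_projIcc zero_le_one).trans_eq ?_
  rw [← abs_mul]
  congr 1
  ring

section Slide

variable {G H N E M : Type*} [NormedAddCommGroup G] [NormedSpace ℝ G] [TopologicalSpace H]
  {I : ModelWithCorners ℝ G H} [TopologicalSpace N] [ChartedSpace H N]
  [NormedAddCommGroup E] [NormedSpace ℝ E] [TopologicalSpace M]

/-- The manifold version of `exists_linear_approx_of_contDiffWithinAt`, for a family of maps with
injective differential. -/
lemma exists_linear_approx_of_contMDiffAt [FiniteDimensional ℝ G] [I.Boundaryless]
    [IsManifold I ∞ N] {h : N × unitInterval → E} {x₀ : N} {t₀ : unitInterval}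
    (hh : ContMDiffAt (I.prod (𝓡∂ 1)) 𝓘(ℝ, E) ∞ h (x₀, t₀))
    (hinj : Function.Injective (mfderiv I 𝓘(ℝ, E) (fun x => h (x, t₀)) x₀)) :
    ∃ (A : G →L[ℝ] E) (c₀ : ℝ) (K : ℝ), 0 < c₀ ∧ (∀ u, c₀ * ‖u‖ ≤ ‖A u‖) ∧ 0 ≤ K ∧ ∀ C > 0,
      ∀ᶠ p : (N × unitInterval) × (N × unitInterval) in 𝓝 ((x₀, t₀), (x₀, t₀)),
        ‖h p.1 - h p.2 - A (extChartAt I x₀ p.1.1 - extChartAt I x₀ p.2.1)‖ ≤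
          C * ‖extChartAt I x₀ p.1.1 - extChartAt I x₀ p.2.1‖ +
            K * |(p.1.2 : ℝ) - (p.2.2 : ℝ)| := by
  set ψ := extChartAt I x₀ with hψ
  let f : G × ℝ → E := fun z => h (ψ.symm z.1, projIcc 0 1 zero_le_one z.2)
  have hf : ContDiffWithinAt ℝ 1 f (univ ×ˢ Icc 0 1) (ψ x₀, (t₀ : ℝ)) := by
    rw [← contMDiffWithinAt_iff_contDiffWithinAt]
    refine ContMDiffWithinAt.of_le (n := ∞) ?_ (by norm_cast)
    have h1 : ContMDiffWithinAt 𝓘(ℝ, G × ℝ) I ∞ (fun z : G × ℝ => ψ.symm z.1) (univ ×ˢ Icc 0 1)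
        (ψ x₀, (t₀ : ℝ)) := by
      have h0 := contMDiffWithinAt_extChartAt_symm_range (n := ∞) (I := I) x₀
        (mem_extChartAt_target x₀)
      rw [I.range_eq_univ] at h0
      exact h0.comp_of_eq (f := Prod.fst) contDiff_fst.contMDiff.contMDiffAt.contMDiffWithinAt
        (fun _ _ => mem_univ _) rfl
    have h2 : ContMDiffWithinAt 𝓘(ℝ, G × ℝ) (𝓡∂ 1) ∞
        (fun z : G × ℝ => projIcc (0 : ℝ) 1 zero_le_one z.2) (univ ×ˢ Icc 0 1)
        (ψ x₀, (t₀ : ℝ)) := by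
      have h0 := contMDiffOn_projIcc (x := (0 : ℝ)) (y := 1) (n := ∞) t₀ t₀.2
      exact h0.comp_of_eq (f := Prod.snd) contDiff_snd.contMDiff.contMDiffAt.contMDiffWithinAt
        (fun _ hz => hz.2) rfl
    have h3 := h1.prodMk h2
    refine ContMDiffAt.comp_contMDiffWithinAt_of_eq hh h3 ?_
    simp [ψ]
  obtain ⟨A, hA, K, hK, hest⟩ := exists_linear_approx_of_contDiffWithinAt t₀.2 hf
  have hAinj : Function.Injective A := by
    have hmd : MDifferentiableAt I 𝓘(ℝ, E) (fun x => h (x, t₀)) x₀ :=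
      (hh.comp x₀ (f := fun x => (x, t₀))
        (contMDiffAt_id.prodMk contMDiffAt_const)).mdifferentiableAt (by simp)
    have he : writtenInExtChartAt I 𝓘(ℝ, E) x₀ (fun x => h (x, t₀)) = fun u => f (u, t₀) := by
      ext u
      simp [writtenInExtChartAt, f, ψ, chartAt_self_eq]
    rw [hmd.mfderiv, I.range_eq_univ, fderivWithin_univ, he, hA.fderiv] at hinj
    exact hinj
  obtain ⟨κ, hκ, hanti⟩ := A.toLinearMap.exists_antilipschitzWith (LinearMap.ker_eq_bot.2 hAinj)
  refine ⟨A, (κ : ℝ)⁻¹, K, by positivity, fun u => ?_, hK, fun C hC => ?_⟩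
  · have := hanti.le_mul_norm_sub u 0
    rw [inv_mul_le_iff₀ (by positivity)]
    simpa using this
  · have hc : ContinuousAt (fun p : (N × unitInterval) × (N × unitInterval) =>
        (((ψ p.1.1, (p.1.2 : ℝ)), (ψ p.2.1, (p.2.2 : ℝ))) : (G × ℝ) × (G × ℝ)))
        ((x₀, t₀), (x₀, t₀)) := by
      have hψc := continuousAt_extChartAt (I := I) x₀
      have e1 : ContinuousAt (fun p : (N × unitInterval) × (N × unitInterval) => ψ p.1.1)
        ((x₀, t₀), (x₀, t₀)) := ContinuousAt.comp (g := ψ) hψc (by fun_prop)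
      have e2 : ContinuousAt (fun p : (N × unitInterval) × (N × unitInterval) => ψ p.2.1)
        ((x₀, t₀), (x₀, t₀)) := ContinuousAt.comp (g := ψ) hψc (by fun_prop)
      fun_prop
    have hs : ∀ᶠ p : (N × unitInterval) × (N × unitInterval) in 𝓝 ((x₀, t₀), (x₀, t₀)),
        p.1.1 ∈ ψ.source ∧ p.2.1 ∈ ψ.source := by
      have hm := extChartAt_source_mem_nhds (I := I) x₀
      refine Filter.Eventually.and ?_ ?_
      · exact (continuous_fst.fst.continuousAt (x := ((x₀, t₀), (x₀, t₀)))).preimage_mem_nhds hm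
      · exact (continuous_snd.fst.continuousAt (x := ((x₀, t₀), (x₀, t₀)))).preimage_mem_nhds hm
    filter_upwards [hc.eventually (hest C hC), hs] with p hp hps
    have := hp p.1.2.2 p.2.2.2
    simpa [f, ψ.left_inv hps.1, ψ.left_inv hps.2] using this

/-- A smooth function is Lipschitz near each point, measured in the chart at that point. -/
lemma exists_lipschitz_in_chart [I.Boundaryless] {s : N → ℝ}
    (hs : ContMDiff I 𝓘(ℝ) ∞ s) (x₀ : N) :
    ∃ K : ℝ, 0 ≤ K ∧ ∀ᶠ p : N × N in 𝓝 (x₀, x₀),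
      |s p.1 - s p.2| ≤ K * ‖extChartAt I x₀ p.1 - extChartAt I x₀ p.2‖ := by
  set ψ := extChartAt I x₀ with hψ
  have h1 := (contMDiffAt_iff.1 (hs x₀)).2
  rw [I.range_eq_univ, contDiffWithinAt_univ] at h1
  obtain ⟨K, w, hw, hK⟩ := (h1.of_le (m := 1) (by norm_cast)).exists_lipschitzOnWith
  have hw' : ψ ⁻¹' w ∩ ψ.source ∈ 𝓝 x₀ :=
    inter_mem ((continuousAt_extChartAt x₀).preimage_mem_nhds hw) (extChartAt_source_mem_nhds x₀)
  refine ⟨K, K.2, ?_⟩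
  filter_upwards [prod_mem_nhds hw' hw'] with p hp
  have := hK.norm_sub_le hp.1.1 hp.2.1
  change ‖s (ψ.symm (ψ p.1)) - s (ψ.symm (ψ p.2))‖ ≤ _ at this
  rwa [ψ.left_inv hp.1.2, ψ.left_inv hp.2.2] at this

/-- Near the diagonal, the displacement between two slides of an immersion has an arbitrarily
small Lipschitz constant with respect to the position: at time `t₀` both slides have the same
derivative, and this derivative is injective. -/
lemma eventually_displacement_le_diag [FiniteDimensional ℝ G] [I.Boundaryless]
    [IsManifold I ∞ N] {h : N × unitInterval → E} {x₀ : N} {t₀ : unitInterval}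
    (hh : ContMDiffAt (I.prod (𝓡∂ 1)) 𝓘(ℝ, E) ∞ h (x₀, t₀))
    (hinj : Function.Injective (mfderiv I 𝓘(ℝ, E) (fun x => h (x, t₀)) x₀))
    {s s' : N → ℝ} (hs : ContMDiff I 𝓘(ℝ) ∞ s) (hs' : ContMDiff I 𝓘(ℝ) ∞ s') {c : ℝ} (hc : 0 < c) :
    ∀ᶠ p : unitInterval × (N × N) in 𝓝 (t₀, (x₀, x₀)),
      ‖(h (p.2.1, slide t₀ s' p.1 p.2.1) - h (p.2.1, slide t₀ s p.1 p.2.1)) -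
        (h (p.2.2, slide t₀ s' p.1 p.2.2) - h (p.2.2, slide t₀ s p.1 p.2.2))‖ ≤
      c * ‖h (p.2.1, slide t₀ s p.1 p.2.1) - h (p.2.2, slide t₀ s p.1 p.2.2)‖ := by
  obtain ⟨A, c₀, K, hc₀, hA, hK, hest⟩ := exists_linear_approx_of_contMDiffAt hh hinj
  -- Both slides are within `2 * C * ‖u‖` of `A u`, where `u` is the difference of the positions.
  -- The displacements thus differ by at most `4 * C * ‖u‖`, the positions by at least
  -- `(c₀ - 2 * C) * ‖u‖`, and `C` is so small that the first is at most `c` times the second.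
  set C := min (c₀ / 4) (c * c₀ / 8) with hC
  have hCpos : 0 < C := lt_min (by positivity) (by positivity)
  have key : ∀ s : N → ℝ, ContMDiff I 𝓘(ℝ) ∞ s →
      ∀ᶠ p : unitInterval × (N × N) in 𝓝 (t₀, (x₀, x₀)),
      ‖h (p.2.1, slide t₀ s p.1 p.2.1) - h (p.2.2, slide t₀ s p.1 p.2.2) -
        A (extChartAt I x₀ p.2.1 - extChartAt I x₀ p.2.2)‖ ≤
      2 * C * ‖extChartAt I x₀ p.2.1 - extChartAt I x₀ p.2.2‖ := by
    intro s hs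
    obtain ⟨K', hK', hlip⟩ := exists_lipschitz_in_chart hs x₀
    have hsl := continuous_slide (t₀ := t₀) hs.continuous
    have e1 : Continuous fun p : unitInterval × (N × N) =>
        (((p.2.1, slide t₀ s p.1 p.2.1), (p.2.2, slide t₀ s p.1 p.2.2)) :
          (N × unitInterval) × (N × unitInterval)) := by
      have a1 := hsl.comp (continuous_fst.prodMk continuous_snd.fst :
        Continuous fun p : unitInterval × (N × N) => (p.1, p.2.1))
      have a2 := hsl.comp (continuous_fst.prodMk continuous_snd.snd :
        Continuous fun p : unitInterval × (N × N) => (p.1, p.2.2))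
      exact (continuous_snd.fst.prodMk a1).prodMk (continuous_snd.snd.prodMk a2)
    have e2 := e1.tendsto (t₀, (x₀, x₀))
    simp only [slide_self] at e2
    have e3 : ∀ᶠ p : unitInterval × (N × N) in 𝓝 (t₀, (x₀, x₀)),
        K * K' * |(p.1 : ℝ) - t₀| < C := by
      refine ContinuousAt.eventually_lt (by fun_prop) continuousAt_const ?_
      simpa using hCpos
    filter_upwards [e2.eventually (hest C hCpos), e3,
      (continuous_snd.tendsto (t₀, (x₀, x₀))).eventually hlip] with p h1 h2 h3
    refine h1.trans ?_
    set U := ‖extChartAt I x₀ p.2.1 - extChartAt I x₀ p.2.2‖ with hU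
    have hU0 : 0 ≤ U := norm_nonneg _
    have h4 := abs_slide_sub_le t₀ s p.1 p.2.1 p.2.2
    calc _ ≤ C * U + K * (K' * U * |(p.1 : ℝ) - t₀|) := by
          gcongr
          exact h4.trans (by gcongr)
      _ = C * U + K * K' * |(p.1 : ℝ) - t₀| * U := by ring
      _ ≤ C * U + C * U := by gcongr
      _ = 2 * C * U := by ring
  filter_upwards [key s hs, key s' hs'] with p h1 h2
  have h3 := hA (extChartAt I x₀ p.2.1 - extChartAt I x₀ p.2.2)
  set U := extChartAt I x₀ p.2.1 - extChartAt I x₀ p.2.2 with hU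
  set a := h (p.2.1, slide t₀ s p.1 p.2.1)
  set a' := h (p.2.2, slide t₀ s p.1 p.2.2)
  set b := h (p.2.1, slide t₀ s' p.1 p.2.1)
  set b' := h (p.2.2, slide t₀ s' p.1 p.2.2)
  have h4 : ‖(b - a) - (b' - a')‖ ≤ 4 * C * ‖U‖ := by
    have : (b - a) - (b' - a') = (b - b' - A U) - (a - a' - A U) := by abel
    rw [this]
    linarith [norm_sub_le (b - b' - A U) (a - a' - A U)]
  have h5 : c₀ / 2 * ‖U‖ ≤ ‖a - a'‖ := by
    have h6 : ‖A U‖ ≤ ‖a - a'‖ + ‖a - a' - A U‖ := by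
      have := norm_sub_le (a - a') (a - a' - A U)
      simpa using this
    have h7 : 2 * C * ‖U‖ ≤ 2 * (c₀ / 4) * ‖U‖ := by
      gcongr
      exact min_le_left _ _
    linarith
  calc _ ≤ 4 * C * ‖U‖ := h4
    _ ≤ 4 * (c * c₀ / 8) * ‖U‖ := by
        gcongr
        exact min_le_right _ _
    _ = c * (c₀ / 2 * ‖U‖) := by ring
    _ ≤ _ := by gcongr

end Slide

/-! ### Ambient isotopies -/

section Ambient

variable {G H N E M : Type*} [NormedAddCommGroup G] [NormedSpace ℝ G] [FiniteDimensional ℝ G]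
  [TopologicalSpace H] {I : ModelWithCorners ℝ G H} [I.Boundaryless]
  [TopologicalSpace N] [ChartedSpace H N] [IsManifold I ∞ N] [CompactSpace N]
  [NormedAddCommGroup E] [NormedSpace ℝ E] [FiniteDimensional ℝ E] [TopologicalSpace M] [T2Space M]

/-- Two slides of an embedding which differ only over a part of `N` that is mapped into a
ball in a chart `e` of `M` are related, for times close to `t₀`, by a homeomorphism of `M` that is
supported in the chart. In the chart, the displacement between the two has a small Lipschitz
constant by compactness of `N × N`, so that it extends to a homeomorphism. -/
lemma eventually_exists_homeomorph_of_slide_of_chart {j : N × unitInterval → M} (hj : Continuous j)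
    {t₀ : unitInterval} (hjinj : Function.Injective fun x => j (x, t₀))
    (e : OpenPartialHomeomorph M E)
    (hsm : ∀ x, j (x, t₀) ∈ e.source →
      ContMDiffAt (I.prod (𝓡∂ 1)) 𝓘(ℝ, E) ∞ (fun p => e (j p)) (x, t₀) ∧
      Function.Injective (mfderiv I 𝓘(ℝ, E) (fun x => e (j (x, t₀))) x))
    {y₀ : E} {r : ℝ} (hr : Metric.closedBall y₀ r ⊆ e.target)
    {s s' : N → ℝ} (hs : ContMDiff I 𝓘(ℝ) ∞ s) (hs' : ContMDiff I 𝓘(ℝ) ∞ s')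
    {T : Set N} (hT : IsClosed T) (hss' : ∀ x ∉ T, s x = s' x)
    (hTe : ∀ x ∈ T, j (x, t₀) ∈ e.source ∧ e (j (x, t₀)) ∈ Metric.ball y₀ r) :
    ∀ᶠ t in 𝓝 t₀, ∃ Φ : M ≃ₜ M, (∀ x ∉ e.source, Φ x = x) ∧
      ∀ x, Φ (j (x, slide t₀ s t x)) = j (x, slide t₀ s' t x) := by
  obtain ⟨c, hc, hdisp⟩ := exists_homeomorph_of_lipschitz_displacement E
  set a : unitInterval → N → M := fun t x => j (x, slide t₀ s t x) with ha
  set b : unitInterval → N → M := fun t x => j (x, slide t₀ s' t x) with hb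
  have hac : Continuous fun p : unitInterval × N => a p.1 p.2 :=
    hj.comp (continuous_snd.prodMk (continuous_slide hs.continuous))
  have hbc : Continuous fun p : unitInterval × N => b p.1 p.2 :=
    hj.comp (continuous_snd.prodMk (continuous_slide hs'.continuous))
  have ha0 : ∀ x, a t₀ x = j (x, t₀) := fun x => by simp [ha]
  have hb0 : ∀ x, b t₀ x = j (x, t₀) := fun x => by simp [hb]
  have hab : ∀ t, ∀ x ∉ T, a t x = b t x := fun t x hx => by simp [ha, hb, slide, hss' x hx]
  have heac : ∀ x, j (x, t₀) ∈ e.source →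
      ContinuousAt (fun p : unitInterval × N => e (a p.1 p.2)) (t₀, x) := fun x hx =>
    ContinuousAt.comp (g := e) (e.continuousAt (by rwa [ha0])) hac.continuousAt
  have hebc : ∀ x, j (x, t₀) ∈ e.source →
      ContinuousAt (fun p : unitInterval × N => e (b p.1 p.2)) (t₀, x) := fun x hx =>
    ContinuousAt.comp (g := e) (e.continuousAt (by rwa [hb0])) hbc.continuousAt
  set D : Set M := e.symm '' Metric.closedBall y₀ r with hD
  have hK : IsCompact (Metric.closedBall y₀ r) := isCompact_closedBall y₀ r
  have hDc : IsClosed D := (hK.image_of_continuousOn (e.continuousOn_symm.mono hr)).isClosed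
  have hDs : D ⊆ e.source := by
    rintro _ ⟨y, hy, rfl⟩
    exact e.map_target (hr hy)
  have hDe : ∀ x ∈ e.source, x ∈ D ↔ e x ∈ Metric.closedBall y₀ r := by
    refine fun x hx => ⟨?_, fun h => ⟨_, h, e.left_inv hx⟩⟩
    rintro ⟨y, hy, rfl⟩
    rwa [e.right_inv (hr hy)]
  -- The displacement has a small Lipschitz constant.
  have E1 : ∀ᶠ t in 𝓝 t₀, ∀ p ∈ (univ : Set (N × N)), a t p.1 ∈ D → a t p.2 ∈ D →
      ‖(e (b t p.1) - e (a t p.1)) - (e (b t p.2) - e (a t p.2))‖ ≤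
        c * ‖e (a t p.1) - e (a t p.2)‖ := by
    refine isCompact_univ.eventually_forall_of_forall_eventually fun ⟨x, y⟩ _ => ?_
    have c1 : Continuous fun z : unitInterval × (N × N) => (z.1, z.2.1) := by fun_prop
    have c2 : Continuous fun z : unitInterval × (N × N) => (z.1, z.2.2) := by fun_prop
    by_cases hx : j (x, t₀) ∈ D
    swap
    · have : ∀ᶠ z : unitInterval × (N × N) in 𝓝 (t₀, (x, y)), a z.1 z.2.1 ∈ Dᶜ :=
        (hac.comp c1).continuousAt.eventually_mem
          (hDc.isOpen_compl.mem_nhds (by simpa [ha0] using hx))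
      filter_upwards [this] with z hz h
      exact absurd h hz
    by_cases hy : j (y, t₀) ∈ D
    swap
    · have : ∀ᶠ z : unitInterval × (N × N) in 𝓝 (t₀, (x, y)), a z.1 z.2.2 ∈ Dᶜ :=
        (hac.comp c2).continuousAt.eventually_mem
          (hDc.isOpen_compl.mem_nhds (by simpa [ha0] using hy))
      filter_upwards [this] with z hz _ h
      exact absurd h hz
    by_cases hxy : x = y
    · subst hxy
      obtain ⟨h1, h2⟩ := hsm x (hDs hx)
      filter_upwards [eventually_displacement_le_diag h1 h2 hs hs' hc] with z hz _ _ using hz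
    · have hne : e (j (x, t₀)) ≠ e (j (y, t₀)) := fun h =>
        hxy (hjinj (e.injOn (hDs hx) (hDs hy) h))
      have k1 := ContinuousAt.comp (f := fun z : unitInterval × (N × N) => (z.1, z.2.1))
        (x := (t₀, (x, y))) (heac x (hDs hx)) c1.continuousAt
      have k2 := ContinuousAt.comp (f := fun z : unitInterval × (N × N) => (z.1, z.2.2))
        (x := (t₀, (x, y))) (heac y (hDs hy)) c2.continuousAt
      have k3 := ContinuousAt.comp (f := fun z : unitInterval × (N × N) => (z.1, z.2.1))
        (x := (t₀, (x, y))) (hebc x (hDs hx)) c1.continuousAt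
      have k4 := ContinuousAt.comp (f := fun z : unitInterval × (N × N) => (z.1, z.2.2))
        (x := (t₀, (x, y))) (hebc y (hDs hy)) c2.continuousAt
      have hlt := ((k3.sub k1).sub (k4.sub k2)).norm.eventually_lt
        ((k1.sub k2).norm.const_mul c) (by
          simpa [ha0, hb0] using mul_pos hc (norm_pos_iff.2 (sub_ne_zero.2 hne)))
      filter_upwards [hlt] with z hz _ _ using hz.le
  -- Over `T`, the displacement is small compared to the distance from the complement of the ball.
  have E2 : ∀ᶠ t in 𝓝 t₀, ∀ x ∈ T, (a t x ∈ e.source ∧ b t x ∈ e.source) ∧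
      ‖e (b t x) - e (a t x)‖ ≤ c * (r - ‖e (a t x) - y₀‖) := by
    refine hT.isCompact.eventually_forall_of_forall_eventually fun x hx => ?_
    obtain ⟨h1, h2⟩ := hTe x hx
    have hlt := ((hebc x h1).sub (heac x h1)).norm.eventually_lt
      ((continuousAt_const (y := r)).sub
        ((heac x h1).sub (continuousAt_const (y := y₀))).norm |>.const_mul c) (by
          simp only [Pi.sub_apply, ha0, hb0, sub_self, norm_zero]
          exact mul_pos hc (sub_pos.2 (mem_ball_iff_norm.1 h2)))
    filter_upwards [hlt, hac.continuousAt.eventually_mem (e.open_source.mem_nhds (by simpa [ha0])),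
      hbc.continuousAt.eventually_mem (e.open_source.mem_nhds (by simpa [hb0]))] with z h3 h4 h5
    exact ⟨⟨h4, h5⟩, h3.le⟩
  filter_upwards [E1, E2] with t h1 h2
  have hTD : ∀ x ∈ T, a t x ∈ D := fun x hx => by
    obtain ⟨⟨h3, -⟩, h4⟩ := h2 x hx
    rw [hDe _ h3, mem_closedBall_iff_norm]
    have := nonneg_of_mul_nonneg_right ((norm_nonneg _).trans h4) hc
    linarith
  -- The points outside the ball take part with displacement zero.
  let pos : {x : N // a t x ∈ D} ⊕ {z : E // z ∉ Metric.ball y₀ r} → E :=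
    Sum.elim (fun x => e (a t x)) (fun z => z)
  let dis : {x : N // a t x ∈ D} ⊕ {z : E // z ∉ Metric.ball y₀ r} → E :=
    Sum.elim (fun x => e (b t x) - e (a t x)) (fun _ => 0)
  have hmix : ∀ (x : N) (z : E), z ∉ Metric.ball y₀ r →
      ‖e (b t x) - e (a t x)‖ ≤ c * ‖e (a t x) - z‖ := by
    intro x z hz
    by_cases hx : x ∈ T
    · refine (h2 x hx).2.trans ?_
      rw [mem_ball_iff_norm, not_lt] at hz
      have h5 := norm_sub_le_norm_sub_add_norm_sub z (e (a t x)) y₀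
      rw [norm_sub_rev z (e (a t x))] at h5
      gcongr
      linarith
    · rw [hab t x hx, sub_self, norm_zero]
      positivity
  obtain ⟨g, hg⟩ := hdisp pos dis (by
    rintro (⟨x, hx⟩ | ⟨z, hz⟩) (⟨y, hy⟩ | ⟨z', hz'⟩)
    · exact h1 (x, y) trivial hx hy
    · simpa [pos, dis] using hmix x z' hz'
    · simpa [pos, dis, norm_sub_rev] using hmix y z hz
    · simp only [dis, Sum.elim_inr, sub_self, norm_zero]
      positivity)
  have hg1 : ∀ x, a t x ∈ D → g (e (a t x)) = e (b t x) := fun x hx => by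
    simpa [pos, dis] using hg (Sum.inl ⟨x, hx⟩)
  have hg2 : ∀ z ∉ Metric.closedBall y₀ r, g z = z := fun z hz => by
    simpa [pos, dis] using hg (Sum.inr ⟨z, fun h => hz (Metric.ball_subset_closedBall h)⟩)
  obtain ⟨Φ, hΦ, hΦ'⟩ := e.exists_homeomorph_extend_by_id hK hr g hg2
  refine ⟨Φ, hΦ', fun x => ?_⟩
  change Φ (a t x) = b t x
  by_cases hx : a t x ∈ D
  · rw [hΦ _ (hDs hx), hg1 x hx]
    refine e.left_inv ?_
    by_cases hxT : x ∈ T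
    · exact (h2 x hxT).1.2
    · rw [← hab t x hxT]
      exact hDs hx
  · rw [← hab t x fun h => hx (hTD x h)]
    by_cases hxs : a t x ∈ e.source
    · rw [hΦ _ hxs, hg2 _ (fun h => hx ((hDe _ hxs).2 h)), e.left_inv hxs]
    · exact hΦ' _ hxs

/-- If the image of an embedding `j (·, t₀)` is covered by charts of `M` inside `O` in which `j` is
smooth and immersive, then for `t` close to `t₀` the embedding `j (·, t)` is the composition of
`j (·, t₀)` with a homeomorphism of `M` supported in `O`. A partition of unity splits the
passage from `t₀` to `t` into finitely many steps inside charts. -/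
lemma eventually_exists_homeomorph [T2Space N] {j : N × unitInterval → M} (hj : Continuous j)
    {t₀ : unitInterval} (hjinj : Function.Injective fun x => j (x, t₀)) {O : Set M}
    (hch : ∀ x, ∃ e : OpenPartialHomeomorph M E, j (x, t₀) ∈ e.source ∧ e.source ⊆ O ∧
      ∀ x, j (x, t₀) ∈ e.source →
        ContMDiffAt (I.prod (𝓡∂ 1)) 𝓘(ℝ, E) ∞ (fun p => e (j p)) (x, t₀) ∧
        Function.Injective (mfderiv I 𝓘(ℝ, E) (fun x => e (j (x, t₀))) x)) :
    ∀ᶠ t in 𝓝 t₀, ∃ Φ : M ≃ₜ M, (∀ x ∉ O, Φ x = x) ∧ ∀ x, Φ (j (x, t₀)) = j (x, t) := by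
  have : LocallyCompactSpace H := I.locallyCompactSpace
  have : LocallyCompactSpace N := ChartedSpace.locallyCompactSpace H N
  choose e hxe heO hsm using hch
  have hball : ∀ x, ∃ r > 0, Metric.closedBall (e x (j (x, t₀))) r ⊆ (e x).target := fun x =>
    Metric.nhds_basis_closedBall.mem_iff.1
      ((e x).open_target.mem_nhds ((e x).map_source (hxe x)))
  choose r hr hrt using hball
  have hjt : Continuous fun x => j (x, t₀) := by fun_prop
  let U : N → Set N := fun x => (fun x => j (x, t₀)) ⁻¹'
    ((e x).source ∩ e x ⁻¹' Metric.ball (e x (j (x, t₀))) (r x))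
  have hU : ∀ x, IsOpen (U x) := fun x =>
    ((e x).isOpen_inter_preimage Metric.isOpen_ball).preimage hjt
  have hxU : ∀ x, x ∈ U x := fun x => ⟨hxe x, Metric.mem_ball_self (hr x)⟩
  obtain ⟨F, hF⟩ := isCompact_univ.elim_finite_subcover U hU
    (fun x _ => mem_iUnion.2 ⟨x, hxU x⟩)
  obtain ⟨ρ, hρ⟩ := SmoothPartitionOfUnity.exists_isSubordinate I isClosed_univ
    (fun i : F => U i) (fun i => hU i) (fun x hx => by
      obtain ⟨i, hi, hxi⟩ := mem_iUnion₂.1 (hF hx)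
      exact mem_iUnion.2 ⟨⟨i, hi⟩, hxi⟩)
  have hsum : ∀ x, ∑ i, ρ i x = 1 := fun x => by
    rw [← finsum_eq_sum_of_fintype]
    exact ρ.sum_eq_one (mem_univ x)
  have hsmooth : ∀ A : Finset F, ContMDiff I 𝓘(ℝ) ∞ fun x => ∑ i ∈ A, ρ i x := fun A =>
    contMDiff_finsetSum fun i _ => (ρ i).contMDiff
  have key : ∀ A : Finset F, ∀ᶠ t in 𝓝 t₀, ∃ Φ : M ≃ₜ M, (∀ x ∉ O, Φ x = x) ∧
      ∀ x, Φ (j (x, t₀)) = j (x, slide t₀ (fun x => ∑ i ∈ A, ρ i x) t x) := by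
    intro A
    induction A using Finset.cons_induction with
    | empty =>
      refine Eventually.of_forall fun t => ⟨Homeomorph.refl M, fun _ _ => rfl, fun x => ?_⟩
      simp [slide]
    | cons i A hi ih =>
      have h := eventually_exists_homeomorph_of_slide_of_chart hj hjinj (e i) (hsm i) (hrt i)
        (hsmooth A) (hsmooth (Finset.cons i A hi)) (T := tsupport (ρ i)) (isClosed_tsupport _)
        (fun x hx => by simp [image_eq_zero_of_notMem_tsupport hx]) (fun x hx => hρ i hx)
      filter_upwards [ih, h] with t ⟨Φ, h1, h2⟩ ⟨Ψ, h3, h4⟩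
      refine ⟨Φ.trans Ψ, fun x hx => ?_, fun x => ?_⟩
      · rw [Homeomorph.trans_apply, h1 x hx, h3 x fun h => hx (heO i h)]
      · rw [Homeomorph.trans_apply, h2, h4]
  filter_upwards [key Finset.univ] with t ⟨Φ, h1, h2⟩
  refine ⟨Φ, h1, fun x => ?_⟩
  rw [h2]
  simp only [slide, hsum, one_mul, add_sub_cancel, projIcc_val]

end Ambient

/-- The extended chart at `x`, restricted to the preimage of the interior of its target, where it is
a homeomorphism between open sets. It contains `x` in its source if `x` is an interior point. -/
noncomputable def interiorChartAt {E H M : Type*} [NormedAddCommGroup E] [NormedSpace ℝ E]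
    [TopologicalSpace H] (I : ModelWithCorners ℝ E H) [TopologicalSpace M] [ChartedSpace H M]
    (x : M) : OpenPartialHomeomorph M E where
  toPartialEquiv := ((extChartAt I x).symm.restr (interior (extChartAt I x).target)).symm
  open_source := by
    have h := (continuousOn_extChartAt (I := I) x).isOpen_inter_preimage
      (isOpen_extChartAt_source x) (isOpen_interior (s := (extChartAt I x).target))
    exact h
  open_target := by
    rw [PartialEquiv.symm_target, PartialEquiv.restr_source, PartialEquiv.symm_source,
      inter_eq_right.2 interior_subset]
    exact isOpen_interior
  continuousOn_toFun := (continuousOn_extChartAt x).mono inter_subset_left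
  continuousOn_invFun := (continuousOn_extChartAt_symm x).mono inter_subset_left

/-- **Ambient isotopy.** A smooth isotopy of embeddings of a closed manifold in the interior of a
manifold `M` is induced by a homeomorphism of `M`, supported in any given open set which
contains the track of the isotopy. -/
theorem exists_homeomorph_of_isotopy {G H N E H' M : Type*}
    [NormedAddCommGroup G] [NormedSpace ℝ G] [FiniteDimensional ℝ G] [TopologicalSpace H]
    {I : ModelWithCorners ℝ G H} [I.Boundaryless] [TopologicalSpace N] [ChartedSpace H N]
    [IsManifold I ∞ N] [CompactSpace N] [T2Space N]
    [NormedAddCommGroup E] [NormedSpace ℝ E] [FiniteDimensional ℝ E] [TopologicalSpace H']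
    {I' : ModelWithCorners ℝ E H'} [TopologicalSpace M] [ChartedSpace H' M] [IsManifold I' ∞ M]
    [T2Space M] {j : N × unitInterval → M} (hj : ContMDiff (I.prod (𝓡∂ 1)) I' ∞ j)
    (hemb : ∀ t : unitInterval, IsSmoothEmb I I' (fun x : N => j (x, t)))
    (hint : ∀ p, j p ∈ I'.interior M) {O : Set M} (hO : IsOpen O) (hjO : ∀ p, j p ∈ O) :
    ∃ Φ : M ≃ₜ M, (∀ x ∉ O, Φ x = x) ∧ ∀ x, Φ (j (x, 0)) = j (x, 1) := by
  let R : unitInterval → unitInterval → Prop := fun t t' =>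
    ∃ Φ : M ≃ₜ M, (∀ x ∉ O, Φ x = x) ∧ ∀ x, Φ (j (x, t)) = j (x, t')
  have hsymm : Std.Symm R := ⟨by
    rintro t₁ t₂ ⟨Φ, h1, h2⟩
    exact ⟨Φ.symm, fun x hx => by rw [Φ.symm_apply_eq, h1 x hx],
      fun x => by rw [Φ.symm_apply_eq, h2]⟩⟩
  refine PreconnectedSpace.induction₂ R ?_ ⟨?_⟩ 0 1
  · intro t
    refine eventually_exists_homeomorph (I := I) (E := E) hj.continuous
      (hemb t).isEmbedding.injective fun x => ?_
    refine ⟨(interiorChartAt I' (j (x, t))).restrOpen O hO, ⟨⟨mem_extChartAt_source _, ?_⟩, hjO _⟩,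
      inter_subset_right, ?_⟩
    · exact I'.isInteriorPoint_iff.1 (hint (x, t))
    · rintro y ⟨⟨hy, -⟩, -⟩
      have hy' : j (y, t) ∈ (extChartAt I' (j (x, t))).source := hy
      have hchart : ContMDiffAt I' 𝓘(ℝ, E) ∞ (extChartAt I' (j (x, t))) (j (y, t)) :=
        contMDiffAt_extChartAt' (by rwa [extChartAt_source] at hy')
      refine ⟨hchart.comp (y, t) (hj (y, t)), ?_⟩
      have hd := mfderiv_comp (I := I) (I' := I') (I'' := 𝓘(ℝ, E)) y
        (g := extChartAt I' (j (x, t))) (f := fun x => j (x, t))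
        (hchart.mdifferentiableAt (by simp)) ((hemb t).contMDiff.mdifferentiableAt (by simp))
      change Function.Injective
        (mfderiv I 𝓘(ℝ, E) (extChartAt I' (j (x, t)) ∘ fun x => j (x, t)) y)
      rw [hd]
      exact (isInvertible_mfderiv_extChartAt hy').injective.comp ((hemb t).injective_mfderiv y)
  · rintro t₁ t₂ t₃ ⟨Φ, h1, h2⟩ ⟨Ψ, h3, h4⟩
    refine ⟨Φ.trans Ψ, fun x hx => ?_, fun x => ?_⟩
    · rw [Homeomorph.trans_apply, h1 x hx, h3 x hx]
    · rw [Homeomorph.trans_apply, h2, h4]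

/-! ### Virtual links -/

lemma IsLink.isCompact {n : ℕ} {F : CompactBase.{u} n} {L : Set F.Thick} (hL : IsLink F L) :
    IsCompact L := by
  obtain ⟨-, N, i, hi, rfl⟩ := hL
  exact isCompact_range hi.contMDiff.continuous

lemma CompactBase.mem_interior_thick_iff {n : ℕ} {F : CompactBase.{u} n} {p : F.Thick} :
    p ∈ (thickModel n).interior F.Thick ↔
      p.1 ∈ (𝓡∂ (n + 1)).interior F ∧ p.2 ∈ (𝓡∂ 1).interior unitInterval := by
  rw [ModelWithCorners.interior_prod]
  rfl

lemma CompactBase.snd_ne_one_of_mem_interior {n : ℕ} {F : CompactBase.{u} n} {p : F.Thick}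
    (hp : p ∈ (thickModel n).interior F.Thick) : p.2 ≠ 1 := by
  intro h
  have h2 := (CompactBase.mem_interior_thick_iff.1 hp).2
  rw [h] at h2
  have h1 : (1 : unitInterval) ∈ (𝓡∂ 1).boundary unitInterval := by
    have := boundary_Icc (x := (0 : ℝ)) (y := 1)
    erw [this]
    exact Or.inr rfl
  rw [← ModelWithCorners.compl_interior] at h1
  exact h1 h2

namespace LinkPair

variable {n : ℕ}

lemma snd_ne_one (P : LinkPair.{u} n) : ∀ p ∈ P.L, p.2 ≠ 1 := fun _ hp =>
  CompactBase.snd_ne_one_of_mem_interior (P.isLink.1 hp)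

lemma nonempty_homotopyEquiv_of_embed {P Q : LinkPair.{u} n} {f : P.F → Q.F}
    (hf : IsSmoothEmb (𝓡∂ (n + 1)) (𝓡∂ (n + 1)) f) (hL : Prod.map f id '' P.L = Q.L) :
    Nonempty (ContinuousMap.HomotopyEquiv P.ConedComplement Q.ConedComplement) := by
  rcases isEmpty_or_nonempty P.F with hP | hP
  · -- As `Q.L` is empty and meets every component, `Q.F` is empty, too.
    have hQ : IsEmpty Q.F.Thick := ⟨fun p => by
      obtain ⟨q, -, hq⟩ := Q.meets p
      rw [← hL] at hq
      obtain ⟨x, -, -⟩ := hq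
      exact hP.elim x.1⟩
    have hP1 : IsEmpty P.ConedComplement :=
      ⟨fun x => Quotient.ind (motive := fun _ => False) (fun p => hP.elim p.1) x.1⟩
    have hQ1 : IsEmpty Q.ConedComplement :=
      ⟨fun x => Quotient.ind (motive := fun _ => False) (fun p => hQ.elim p) x.1⟩
    exact ⟨Homeomorph.empty.toHomotopyEquiv⟩
  · have h := Coned.nonempty_homotopyEquiv_compl_of_isEmbedding hf.isEmbedding
      P.isLink.isCompact P.snd_ne_one (fun p hp => mem_interior_iff_mem_nhds.2
        (range_mem_nhds_of_injective_mfderiv rfl (hf.contMDiff p.1) (hf.injective_mfderiv p.1)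
          (CompactBase.mem_interior_thick_iff.1 (P.isLink.1 hp)).1))
    rwa [hL] at h

lemma nonempty_homotopyEquiv_of_isotopy {P : LinkPair.{u} n} {L' : Set P.F.Thick}
    (h : SmoothlyIsotopic P.F P.L L') :
    Nonempty (ContinuousMap.HomotopyEquiv P.ConedComplement
      ↥((Quotient.mk (coneSetoid P.F) '' L')ᶜ : Set (Coned P.F))) := by
  obtain ⟨N, j, hj, hemb, hint, h0, h1⟩ := h
  have hO : IsOpen {p : P.F.Thick | p.2 ≠ 1} := isOpen_ne_fun continuous_snd continuous_const
  obtain ⟨Φ, hΦ, hΦj⟩ := exists_homeomorph_of_isotopy hj hemb hint hO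
    fun p => CompactBase.snd_ne_one_of_mem_interior (hint p)
  have hL : Φ '' P.L = L' := by
    rw [← h0, ← h1, ← range_comp]
    exact congrArg range (funext hΦj)
  have := Coned.nonempty_homotopyEquiv_compl_of_homeomorph Φ (fun x => hΦ _ (by simp)) P.snd_ne_one
  rwa [hL] at this

lemma nonempty_homotopyEquiv_of_virtuallyEquivalent {P Q : LinkPair.{u} n}
    (h : VirtuallyEquivalent P Q) :
    Nonempty (ContinuousMap.HomotopyEquiv P.ConedComplement Q.ConedComplement) := by
  induction h with
  | rel P Q h =>
    cases h with
    | embed _ _ f hf hL => exact nonempty_homotopyEquiv_of_embed hf hL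
    | isotopy F L L' h m h' m' hLL' =>
      exact nonempty_homotopyEquiv_of_isotopy (P := ⟨F, L, h, m⟩) hLL'
  | refl P => exact ⟨ContinuousMap.HomotopyEquiv.refl _⟩
  | symm P Q _ ih => exact ih.map ContinuousMap.HomotopyEquiv.symm
  | trans P Q R _ _ ih ih' => exact ih.elim fun e => ih'.map e.trans

lemma IsInBall.nonempty_homotopyEquiv {P : LinkPair.{u} n} (h : P.IsInBall) :
    Nonempty (ContinuousMap.HomotopyEquiv P.ConedComplement P.Complement) := by
  obtain ⟨e⟩ := h
  have : ContractibleSpace (Metric.closedBall (0 : EuclideanSpace ℝ (Fin (n + 1))) 1) :=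
    (convex_closedBall _ _).contractibleSpace ⟨0, Metric.mem_closedBall_self zero_le_one⟩
  have : ContractibleSpace P.F := e.contractibleSpace
  exact Coned.nonempty_homotopyEquiv_compl_of_contractible P.isLink.isCompact P.snd_ne_one

end LinkPair

theorem mainTheorem4 (n : ℕ) :
    -- the homotopy type of `h(F) - L` is invariant under virtual equivalence
    (∀ P Q : LinkPair.{u} n, VirtuallyEquivalent P Q →
      Nonempty (ContinuousMap.HomotopyEquiv P.ConedComplement Q.ConedComplement)) ∧
    -- for links in `D^{n+1} × [0,1]` it is the homotopy type of the link complement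
    (∀ P : LinkPair.{u} n, P.IsInBall →
      Nonempty (ContinuousMap.HomotopyEquiv P.ConedComplement P.Complement)) ∧
    -- every homotopy invariant of the complement of links in the ball extends to virtual links
    (∀ (α : Type v) (inv : TopCat.{u} → α),
      (∀ X Y : TopCat.{u}, Nonempty (ContinuousMap.HomotopyEquiv X Y) → inv X = inv Y) →
      ∃ J : VirtualLink.{u} n → α,
        (∀ P : LinkPair.{u} n, J P.virtualLink = inv (TopCat.of P.ConedComplement)) ∧
        (∀ P : LinkPair.{u} n, P.IsInBall →
          J P.virtualLink = inv (TopCat.of P.Complement))) := by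
  refine ⟨fun P Q => LinkPair.nonempty_homotopyEquiv_of_virtuallyEquivalent,
    fun P => LinkPair.IsInBall.nonempty_homotopyEquiv, fun α inv hinv => ?_⟩
  exact ⟨Quotient.lift (fun P : LinkPair.{u} n => inv (TopCat.of P.ConedComplement))
    fun P Q h => hinv _ _ (LinkPair.nonempty_homotopyEquiv_of_virtuallyEquivalent h),
    fun P => rfl, fun P hP => hinv (TopCat.of P.ConedComplement) (TopCat.of P.Complement)
      hP.nonempty_homotopyEquiv⟩
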